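/- Let rectangular objects $1,\dots,N$ have dimensions $d_{kx},d_{ky}\ge 0$ and clearances $\sigma^-_{ks},\sigma^+_{ks}\ge 0$ on their lower and upper faces in each direction $s\in\{x,y\}$; they are to be packed into a region with dimensions $r_x\times r_y$. Put $$LB_{ks}=\tfrac12 d_{ks}+\sigma^-_{ks},\qquad UB_{ks}=r_s-\tfrac12 d_{ks}-\sigma^+_{ks},$$ and for $k\ne l$ let $PM_{kls}$ be real numbers (the precedence margins) with $$PM_{kls}\ \ge\ \tfrac12 d_{ks}+\tfrac12 d_{ls}+\max\{\sigma^+_{ks},\sigma^-_{ls}\};$$ equality is the basic case. Let $i<j$ be two objects, let $\mathscr F_{ij}=\{(i,j,x),(j,i,x),(i,j,y),(j,i,y)\}$, and assume that $PM_{kls}<UB_{ls}-LB_{ks}$ for every $(k,l,s)\in\mathscr F_{ij}$. Then the Refined Unary formulation restricted to the two objects $i,j$ is ideal (that is, the formulation is pairwise-ideal): with the real variables $c_{ks}$ ($k\in\{i,j\}$, $s\in\{x,y\}$; centers of the objects) and $\delta_{kls}$ ($(k,l,s)\in\mathscr F_{ij}$), every extreme point $(c,\delta)$ of the polyhedron given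 by $$c_{ls}\ge LB_{ls}+(LB_{ks}+PM_{kls}-LB_{ls})\,\delta_{kls}\qquad\forall (k,l,s)\in\mathscr F_{ij},$$ $$c_{ks}\le UB_{ks}+(UB_{ls}-PM_{kls}-UB_{ks})\,\delta_{kls}\qquad\forall (k,l,s)\in\mathscr F_{ij},$$ $$c_{ks}-c_{ls}\le PM_{lks}-(PM_{lks}+PM_{kls})\,\delta_{kls}+(UB_{ks}-PM_{lks}-LB_{ls})\,\delta_{lks}\qquad\forall (k,l,s)\in\mathscr F_{ij},$$ $$\delta_{ijs}+\delta_{jis}\le 1\quad\forall s\in\{x,y\},\qquad \delta_{ijx}+\delta_{jix}+\delta_{ijy}+\delta_{jiy}\ge 1,$$ $$0\le\delta_{kls}\le 1\qquad\forall (k,l,s)\in\mathscr F_{ij}$$ (the continuous relaxation of the formulation, in which $\delta_{kls}\in\{0,1\}$) satisfies $\delta_{kls}\in\{0,1\}$ for all $(k,l,s)\in\mathscr F_{ij}$. -/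

import Mathlib

/-! Two-dimensional rectangle packing with clearances, the refined unary mixed-binary formulation
of the pairwise non-overlap conditions, and idealness of mixed-binary linear programs. -/

namespace RectPacking

/-- The two coordinate directions. -/
inductive Dir
  | x
  | y

/-- The data of a rectangle packing problem with `N` objects: the dimensions `r` of the region, the
dimensions `d` of the objects, the clearances `clrNeg` (`σ⁻`) and `clrPos` (`σ⁺`) on the lower and
the upper faces of the objects, and the precedence margins `PM k l s` between distinct objects. -/
structure Instance (N : ℕ) where
  r : Dir → ℝ
  d : Fin N → Dir → ℝ
  clrNeg : Fin N → Dir → ℝ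
  clrPos : Fin N → Dir → ℝ
  PM : Fin N → Fin N → Dir → ℝ

namespace Instance

variable {N : ℕ}

/-- Lower bound for the center of object `k` in direction `s`. -/
noncomputable def LB (P : Instance N) (k : Fin N) (s : Dir) : ℝ :=
  P.d k s / 2 + P.clrNeg k s

/-- Upper bound for the center of object `k` in direction `s`. -/
noncomputable def UB (P : Instance N) (k : Fin N) (s : Dir) : ℝ :=
  P.r s - P.d k s / 2 - P.clrPos k s

/-- The margin by which the center of `l` has to exceed that of `k` in direction `s`, so that
neither object overlaps the other or its clearance. -/
noncomputable def clearanceMargin (P : Instance N) (k l : Fin N) (s : Dir) : ℝ :=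
  P.d k s / 2 + P.d l s / 2 + max (P.clrPos k s) (P.clrNeg l s)

/-- Dimensions and clearances are nonnegative, and the precedence margins are at least the margins
needed for the objects and their clearances (equality is the basic case; larger margins encode
further displacement constraints). -/
structure Admissible (P : Instance N) : Prop where
  d_nonneg : ∀ k s, 0 ≤ P.d k s
  clrNeg_nonneg : ∀ k s, 0 ≤ P.clrNeg k s
  clrPos_nonneg : ∀ k s, 0 ≤ P.clrPos k s
  margin_le : ∀ k l, k ≠ l → ∀ s, P.clearanceMargin k l s ≤ P.PM k l s

/-- The sub-instance with only the two objects `i` and `j`. -/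
def pair (P : Instance N) (i j : Fin N) : Instance 2 where
  r := P.r
  d := fun k => P.d (![i, j] k)
  clrNeg := fun k => P.clrNeg (![i, j] k)
  clrPos := fun k => P.clrPos (![i, j] k)
  PM := fun k l => P.PM (![i, j] k) (![i, j] l)

end Instance

/-- The four ways `(k, l, s)` in which one of the objects `i`, `j` can precede the other. -/
def precedences {N : ℕ} (i j : Fin N) : Set (Fin N × Fin N × Dir) :=
  {(i, j, Dir.x), (j, i, Dir.x), (i, j, Dir.y), (j, i, Dir.y)}

/-- Index set of the binary variables: triples `(k, l, s)` with `k ≠ l`, that is, the union of the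
sets `precedences i j` over all pairs `i < j`. -/
abbrev PrecIndex (N : ℕ) : Type :=
  {t : Fin N × Fin N × Dir // t.1 ≠ t.2.1}

/-- A choice of the variables: `z.1 (k, s)` is the coordinate `c_{ks}` of the center of object `k`,
and `z.2 ⟨(k, l, s), h⟩` is the indicator `δ_{kls}` of "`k` precedes `l` in direction `s`". -/
abbrev Point (N : ℕ) : Type :=
  (Fin N × Dir → ℝ) × (PrecIndex N → ℝ)

/-- The linear constraints of the refined unary formulation, for every pair of objects. -/
structure RUConstraints {N : ℕ} (P : Instance N) (z : Point N) : Prop where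
  lb : ∀ (k l : Fin N) (h : k ≠ l) (s : Dir),
    z.1 (l, s) ≥ P.LB l s + (P.LB k s + P.PM k l s - P.LB l s) * z.2 ⟨(k, l, s), h⟩
  ub : ∀ (k l : Fin N) (h : k ≠ l) (s : Dir),
    z.1 (k, s) ≤ P.UB k s + (P.UB l s - P.PM k l s - P.UB k s) * z.2 ⟨(k, l, s), h⟩
  prec : ∀ (k l : Fin N) (h : k ≠ l) (s : Dir),
    z.1 (k, s) - z.1 (l, s) ≤
      P.PM l k s - (P.PM l k s + P.PM k l s) * z.2 ⟨(k, l, s), h⟩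
        + (P.UB k s - P.PM l k s - P.LB l s) * z.2 ⟨(l, k, s), h.symm⟩
  tight : ∀ (i j : Fin N) (h : i < j) (s : Dir),
    z.2 ⟨(i, j, s), h.ne⟩ + z.2 ⟨(j, i, s), h.ne'⟩ ≤ 1
  disj : ∀ (i j : Fin N) (h : i < j),
    z.2 ⟨(i, j, Dir.x), h.ne⟩ + z.2 ⟨(j, i, Dir.x), h.ne'⟩
      + z.2 ⟨(i, j, Dir.y), h.ne⟩ + z.2 ⟨(j, i, Dir.y), h.ne'⟩ ≥ 1

/-- The region cut out by the linear constraints of the refined unary formulation. The formulation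
itself is this region together with the requirement that every `δ_{kls}` is `0` or `1`. -/
def RU {N : ℕ} (P : Instance N) : Set (Point N) :=
  {z | RUConstraints P z}

section Ideal

variable {I B : Type*}

/-- Continuous relaxation of the mixed-binary linear program with linear constraint region `L`,
continuous variables `z.1` and binary variables `z.2`: the condition that `z.2 b` is `0` or `1` is
relaxed to `0 ≤ z.2 b ≤ 1`. -/
def relaxation (L : Set ((I → ℝ) × (B → ℝ))) : Set ((I → ℝ) × (B → ℝ)) :=
  {z | z ∈ L ∧ ∀ b, 0 ≤ z.2 b ∧ z.2 b ≤ 1}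

/-- The program is ideal: every extreme point of its relaxation has all its binary variables in
`{0, 1}`. -/
def IsIdeal (L : Set ((I → ℝ) × (B → ℝ))) : Prop :=
  ∀ z ∈ Set.extremePoints ℝ (relaxation L), ∀ b, z.2 b = 0 ∨ z.2 b = 1

end Ideal

end RectPacking

/-!
The relaxation is the convex hull of its points with binary `δ`; since it is convex, each of its
extreme points is then one of these.

For one direction, write `a, b` for the centers of the two objects and `p, q` for the two precedence
indicators. Each of the three binary choices `(p, q) = (0, 0), (1, 0), (0, 1)` leaves for `(a, b)` a
hexagon given by bounds on `a`, `b` and `a - b`, and the bounds in the formulation are exactly the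
sums of the bounds of these hexagons with weights `1 - p - q, p, q`. Admissibility and the upper
bounds on the margins make all these bounds tight, and the edges of the hexagons have only three
directions, so in the plane the sums of tight bounds describe the Minkowski sum
(`Hexagon.Tight.exists_split`). Hence every feasible `(a, b, p, q)` is a combination with these
weights of three binary feasible points (`SliceData.exists_decomposition`).

The directions are linked only by the requirement that the weights `m`, `m'` of the cells with some
precedence satisfy `m + m' ≥ 1`. This makes
`(1 - m) (v₀, n') + (1 - m') (n, v₀') + (m + m' - 1) (n, n')` a convex combination that couples
`(1 - m) v₀ + m n` and `(1 - m') v₀' + m' n'` without using `(v₀, v₀')`, which is the only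
forbidden pair of cells (`prod_mem_convexHull_coupling`).
-/

namespace RectPacking

/-! ### Minkowski sums of hexagons with fixed edge directions -/

/-- Lower and upper bounds for `a`, for `b` and for the difference `g = a - b` of the coordinates of
a point `(a, b)` of the plane. -/
structure Hexagon where
  aLo : ℝ
  aHi : ℝ
  bLo : ℝ
  bHi : ℝ
  gLo : ℝ
  gHi : ℝ

namespace Hexagon

/-- The point `(a, b)` satisfies all six bounds. -/
structure Mem (H : Hexagon) (v : ℝ × ℝ) : Prop where
  aLo : H.aLo ≤ v.1
  aHi : v.1 ≤ H.aHi
  bLo : H.bLo ≤ v.2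
  bHi : v.2 ≤ H.bHi
  gLo : H.gLo ≤ v.1 - v.2
  gHi : v.1 - v.2 ≤ H.gHi

/-- Each of the six bounds is attained by a point satisfying the others. This is expressed by the
triangle inequalities of the difference-bound matrix together with consistency of each interval. -/
structure Tight (H : Hexagon) : Prop where
  a : H.aLo ≤ H.aHi
  b : H.bLo ≤ H.bHi
  g : H.gLo ≤ H.gHi
  aHi : H.aHi ≤ H.bHi + H.gHi
  aLo : H.bLo + H.gLo ≤ H.aLo
  bHi : H.bHi ≤ H.aHi - H.gLo
  bLo : H.aLo - H.gHi ≤ H.bLo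
  gHi : H.gHi ≤ H.aHi - H.bLo
  gLo : H.aLo - H.bHi ≤ H.gLo

/-- Sum of the bounds. -/
def add (H K : Hexagon) : Hexagon :=
  ⟨H.aLo + K.aLo, H.aHi + K.aHi, H.bLo + K.bLo, H.bHi + K.bHi, H.gLo + K.gLo, H.gHi + K.gHi⟩

/-- Multiplication of the bounds by a scalar, meant to be nonnegative. -/
def scale (w : ℝ) (H : Hexagon) : Hexagon :=
  ⟨w * H.aLo, w * H.aHi, w * H.bLo, w * H.bHi, w * H.gLo, w * H.gHi⟩

theorem Tight.add {H K : Hexagon} (hH : H.Tight) (hK : K.Tight) : (H.add K).Tight := by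
  obtain ⟨h1, h2, h3, h4, h5, h6, h7, h8, h9⟩ := hH
  obtain ⟨k1, k2, k3, k4, k5, k6, k7, k8, k9⟩ := hK
  constructor <;> simp only [Hexagon.add] <;> linarith

theorem Tight.scale {H : Hexagon} (hH : H.Tight) {w : ℝ} (hw : 0 ≤ w) : (H.scale w).Tight := by
  obtain ⟨h1, h2, h3, h4, h5, h6, h7, h8, h9⟩ := hH
  constructor <;> simp only [Hexagon.scale, ← mul_add, ← mul_sub] <;> gcongr

/-- Three intervals for `x`, `y` and `x - y` are simultaneously attained as soon as each of them is
nonempty and the interval for `x - y` meets the difference of the other two. -/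
theorem exists_mem_Icc_sub_mem_Icc {xl xh yl yh gl gh : ℝ} (hx : xl ≤ xh) (hy : yl ≤ yh) (hg : gl ≤ gh)
    (h1 : xl - yh ≤ gh) (h2 : gl ≤ xh - yl) :
    ∃ x y : ℝ, xl ≤ x ∧ x ≤ xh ∧ yl ≤ y ∧ y ≤ yh ∧ gl ≤ x - y ∧ x - y ≤ gh := by
  refine ⟨max xl (yl + gl), max yl (max xl (yl + gl) - gh), le_max_left _ _, ?_, le_max_left _ _,
    ?_, ?_, ?_⟩
  · exact max_le hx (by linarith)
  · refine max_le hy ?_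
    have : max xl (yl + gl) ≤ yh + gh := max_le (by linarith) (by linarith)
    linarith
  · have h3 := le_max_right xl (yl + gl)
    have : max yl (max xl (yl + gl) - gh) ≤ max xl (yl + gl) - gl :=
      max_le (by linarith) (by linarith)
    linarith
  · have := le_max_right yl (max xl (yl + gl) - gh)
    linarith

theorem Tight.exists_mem {H : Hexagon} (hH : H.Tight) : ∃ v, H.Mem v := by
  obtain ⟨h1, h2, h3, h4, h5, h6, h7, h8, h9⟩ := hH
  obtain ⟨x, y, k1, k2, k3, k4, k5, k6⟩ :=
    exists_mem_Icc_sub_mem_Icc h1 h2 h3 (by linarith) (by linarith)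
  exact ⟨(x, y), k1, k2, k3, k4, k5, k6⟩

/-- The Minkowski sum of two tight hexagons is described by the sums of their bounds. -/
theorem Tight.exists_split {H K : Hexagon} (hH : H.Tight) (hK : K.Tight) {v : ℝ × ℝ}
    (hv : (H.add K).Mem v) : ∃ u u', H.Mem u ∧ K.Mem u' ∧ u + u' = v := by
  obtain ⟨h1, h2, h3, h4, h5, h6, h7, h8, h9⟩ := hH
  obtain ⟨k1, k2, k3, k4, k5, k6, k7, k8, k9⟩ := hK
  obtain ⟨v1, v2, v3, v4, v5, v6⟩ := hv
  simp only [Hexagon.add] at v1 v2 v3 v4 v5 v6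
  obtain ⟨a, b⟩ := v
  simp only at v1 v2 v3 v4 v5 v6
  -- `u = (x, y)` has to satisfy the bounds of `H` and the reflected bounds of `K`.
  obtain ⟨x, y, hx, hx', hy, hy', hg, hg'⟩ := exists_mem_Icc_sub_mem_Icc
    (xl := max H.aLo (a - K.aHi)) (xh := min H.aHi (a - K.aLo))
    (yl := max H.bLo (b - K.bHi)) (yh := min H.bHi (b - K.bLo))
    (gl := max H.gLo (a - b - K.gHi)) (gh := min H.gHi (a - b - K.gLo))
    (max_le (le_min (by linarith) (by linarith)) (le_min (by linarith) (by linarith)))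
    (max_le (le_min (by linarith) (by linarith)) (le_min (by linarith) (by linarith)))
    (max_le (le_min (by linarith) (by linarith)) (le_min (by linarith) (by linarith)))
    (by
      rw [sub_le_iff_le_add]
      refine max_le ?_ ?_ <;> rw [← sub_le_iff_le_add'] <;> refine le_min ?_ ?_ <;>
        rw [sub_le_comm] <;> refine le_min ?_ ?_ <;> linarith)
    (by
      rw [le_sub_iff_add_le]
      refine le_min ?_ ?_ <;> rw [← le_sub_iff_add_le] <;> refine max_le ?_ ?_ <;>
        rw [le_sub_comm] <;> refine max_le ?_ ?_ <;> linarith)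
  simp only [max_le_iff, le_min_iff] at hx hx' hy hy' hg hg'
  refine ⟨(x, y), (a - x, b - y), ⟨hx.1, hx'.1, hy.1, hy'.1, hg.1, hg'.1⟩,
    ⟨?_, ?_, ?_, ?_, ?_, ?_⟩, by simp⟩ <;> simp only <;> linarith

/-- The case `w = 0` uses that a tight hexagon is nonempty. -/
theorem Tight.exists_eq_smul {H : Hexagon} (hH : H.Tight) {w : ℝ} (hw : 0 ≤ w) {v : ℝ × ℝ}
    (hv : (H.scale w).Mem v) : ∃ u, H.Mem u ∧ v = w • u := by
  obtain ⟨v1, v2, v3, v4, v5, v6⟩ := hv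
  simp only [Hexagon.scale] at v1 v2 v3 v4 v5 v6
  rcases hw.eq_or_lt with rfl | hw
  · obtain ⟨u, hu⟩ := hH.exists_mem
    refine ⟨u, hu, ?_⟩
    ext <;> simp <;> linarith
  · have key : v = w • (w⁻¹ • v) := by rw [smul_smul, mul_inv_cancel₀ hw.ne', one_smul]
    refine ⟨w⁻¹ • v, ?_, key⟩
    rw [key] at v1 v2 v3 v4 v5 v6
    simp only [Prod.smul_fst _ (w⁻¹ • v), Prod.smul_snd _ (w⁻¹ • v), smul_eq_mul, ← mul_sub,
      mul_le_mul_iff_right₀ hw] at v1 v2 v3 v4 v5 v6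
    exact ⟨v1, v2, v3, v4, v5, v6⟩

end Hexagon

/-! ### The formulation in a single direction -/

/-- Bounds `Li ≤ a ≤ Ui`, `Lj ≤ b ≤ Uj` for the centers of two objects in one direction, and their
precedence margins, with the inequalities that admissibility and strictness of the margins give. -/
structure SliceData where
  Li : ℝ
  Ui : ℝ
  Lj : ℝ
  Uj : ℝ
  Pij : ℝ
  Pji : ℝ
  margin_add : 0 ≤ Pij + Pji
  Lj_le : Lj ≤ Li + Pij
  le_Ui : Uj - Pij ≤ Ui
  Li_le : Li ≤ Lj + Pji
  le_Uj : Ui - Pji ≤ Uj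
  ij_le : Pij ≤ Uj - Li
  ji_le : Pji ≤ Ui - Lj

/-- The variables of one direction: the centers `(a, b)` of the two objects and the indicators
`(p, q)` of "the first precedes the second" and of the reverse. -/
abbrev Slice : Type := (ℝ × ℝ) × (ℝ × ℝ)

namespace SliceData

variable (D : SliceData)

/-- The relaxed constraints that involve only one direction. -/
structure Feasible (v : Slice) : Prop where
  bLo : D.Lj + (D.Li + D.Pij - D.Lj) * v.2.1 ≤ v.1.2
  aLo : D.Li + (D.Lj + D.Pji - D.Li) * v.2.2 ≤ v.1.1
  aHi : v.1.1 ≤ D.Ui + (D.Uj - D.Pij - D.Ui) * v.2.1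
  bHi : v.1.2 ≤ D.Uj + (D.Ui - D.Pji - D.Uj) * v.2.2
  gHi : v.1.1 - v.1.2 ≤ D.Pji - (D.Pji + D.Pij) * v.2.1 + (D.Ui - D.Pji - D.Lj) * v.2.2
  gLo : v.1.2 - v.1.1 ≤ D.Pij - (D.Pij + D.Pji) * v.2.2 + (D.Uj - D.Pij - D.Li) * v.2.1
  p_nonneg : 0 ≤ v.2.1
  q_nonneg : 0 ≤ v.2.2
  add_le : v.2.1 + v.2.2 ≤ 1

/-- The positions of the two objects when neither has to precede the other. -/
def hexNone : Hexagon := ⟨D.Li, D.Ui, D.Lj, D.Uj, -D.Pij, D.Pji⟩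

/-- The positions of the two objects when the first has to precede the second. -/
def hexFst : Hexagon :=
  ⟨D.Li, D.Uj - D.Pij, D.Li + D.Pij, D.Uj, D.Li - D.Uj, -D.Pij⟩

/-- The positions of the two objects when the second has to precede the first. -/
def hexSnd : Hexagon :=
  ⟨D.Lj + D.Pji, D.Ui, D.Lj, D.Ui - D.Pji, D.Pji, D.Ui - D.Lj⟩

theorem hexNone_tight : D.hexNone.Tight := by
  obtain ⟨Li, Ui, Lj, Uj, Pij, Pji, h1, h2, h3, h4, h5, h6, h7⟩ := D
  constructor <;> simp only [hexNone] <;> linarith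

theorem hexFst_tight : D.hexFst.Tight := by
  obtain ⟨Li, Ui, Lj, Uj, Pij, Pji, h1, h2, h3, h4, h5, h6, h7⟩ := D
  constructor <;> simp only [hexFst] <;> linarith

theorem hexSnd_tight : D.hexSnd.Tight := by
  obtain ⟨Li, Ui, Lj, Uj, Pij, Pji, h1, h2, h3, h4, h5, h6, h7⟩ := D
  constructor <;> simp only [hexSnd] <;> linarith

theorem feasible_none {u : ℝ × ℝ} (hu : D.hexNone.Mem u) : D.Feasible (u, (0, 0)) := by
  obtain ⟨h1, h2, h3, h4, h5, h6⟩ := hu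
  simp only [hexNone] at h1 h2 h3 h4 h5 h6
  constructor <;> simp only <;> linarith

theorem feasible_fst {u : ℝ × ℝ} (hu : D.hexFst.Mem u) : D.Feasible (u, (1, 0)) := by
  obtain ⟨h1, h2, h3, h4, h5, h6⟩ := hu
  simp only [hexFst] at h1 h2 h3 h4 h5 h6
  constructor <;> simp only <;> linarith

theorem feasible_snd {u : ℝ × ℝ} (hu : D.hexSnd.Mem u) : D.Feasible (u, (0, 1)) := by
  obtain ⟨h1, h2, h3, h4, h5, h6⟩ := hu
  simp only [hexSnd] at h1 h2 h3 h4 h5 h6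
  constructor <;> simp only <;> linarith

/-- A feasible point of a single direction is the combination of three binary feasible points with
the weights given by its own indicators. -/
theorem exists_decomposition {v : Slice} (hv : D.Feasible v) :
    ∃ u₀ u₁ u₂ : ℝ × ℝ, D.Feasible (u₀, (0, 0)) ∧ D.Feasible (u₁, (1, 0)) ∧
      D.Feasible (u₂, (0, 1)) ∧
      v = (1 - v.2.1 - v.2.2) • ((u₀, (0, 0)) : Slice) + v.2.1 • ((u₁, (1, 0)) : Slice)
        + v.2.2 • ((u₂, (0, 1)) : Slice) := by
  obtain ⟨c, p, q⟩ := v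
  obtain ⟨h1, h2, h3, h4, h5, h6, hp, hq, hpq⟩ := hv
  simp only at h1 h2 h3 h4 h5 h6 hp hq hpq
  have hw : 0 ≤ 1 - p - q := by linarith
  have t₀ := D.hexNone_tight.scale hw
  have t₁ := D.hexFst_tight.scale hp
  have t₂ := D.hexSnd_tight.scale hq
  have hc : (((D.hexNone.scale (1 - p - q)).add (D.hexFst.scale p)).add
      (D.hexSnd.scale q)).Mem c := by
    constructor <;> simp only [Hexagon.add, Hexagon.scale, hexNone, hexFst, hexSnd] <;> linarith
  obtain ⟨w, x₂, hw', hx₂, rfl⟩ := (t₀.add t₁).exists_split t₂ hc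
  obtain ⟨x₀, x₁, hx₀, hx₁, rfl⟩ := t₀.exists_split t₁ hw'
  obtain ⟨u₀, hu₀, rfl⟩ := D.hexNone_tight.exists_eq_smul hw hx₀
  obtain ⟨u₁, hu₁, rfl⟩ := D.hexFst_tight.exists_eq_smul hp hx₁
  obtain ⟨u₂, hu₂, rfl⟩ := D.hexSnd_tight.exists_eq_smul hq hx₂
  refine ⟨u₀, u₁, u₂, D.feasible_none hu₀, D.feasible_fst hu₁, D.feasible_snd hu₂, ?_⟩
  ext <;> simp

end SliceData

/-! ### Coupling the two directions -/

/-- Normalizes the part of a convex combination of `v₀`, `v₁`, `v₂` that does not involve `v₀`. -/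
theorem exists_mem_convexHull_pair_smul_eq {E : Type*} [AddCommGroup E] [Module ℝ E] (v₁ v₂ : E)
    {p q : ℝ} (hp : 0 ≤ p) (hq : 0 ≤ q) :
    ∃ n ∈ convexHull ℝ {v₁, v₂}, p • v₁ + q • v₂ = (p + q) • n := by
  rcases (add_nonneg hp hq).eq_or_lt with h | h
  · have hp0 : p = 0 := by linarith
    have hq0 : q = 0 := by linarith
    exact ⟨v₁, subset_convexHull ℝ _ (by simp), by simp [hp0, hq0]⟩
  · refine ⟨(p / (p + q)) • v₁ + (q / (p + q)) • v₂, ?_, ?_⟩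
    · rw [convexHull_pair]
      exact ⟨_, _, by positivity, by positivity, by field_simp, rfl⟩
    · rw [smul_add, smul_smul, smul_smul, mul_div_cancel₀ _ h.ne', mul_div_cancel₀ _ h.ne']

/-- Two convex combinations of three points can be coupled without using the pair `(v₀, v₀')`, as
soon as the weights of `v₀` and of `v₀'` add up to at most one. -/
theorem prod_mem_convexHull_coupling {E F : Type*} [AddCommGroup E] [Module ℝ E] [AddCommGroup F]
    [Module ℝ F] (v₀ v₁ v₂ : E) (v₀' v₁' v₂' : F) {p q p' q' : ℝ} (hp : 0 ≤ p) (hq : 0 ≤ q)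
    (hpq : p + q ≤ 1) (hp' : 0 ≤ p') (hq' : 0 ≤ q') (hpq' : p' + q' ≤ 1)
    (hsum : 1 ≤ p + q + p' + q') :
    ((1 - p - q) • v₀ + p • v₁ + q • v₂, (1 - p' - q') • v₀' + p' • v₁' + q' • v₂') ∈
      convexHull ℝ ({v₀} ×ˢ {v₁', v₂'} ∪ {v₁, v₂} ×ˢ {v₀'} ∪ {v₁, v₂} ×ˢ {v₁', v₂'}) := by
  obtain ⟨n, hn, e⟩ := exists_mem_convexHull_pair_smul_eq v₁ v₂ hp hq
  obtain ⟨n', hn', e'⟩ := exists_mem_convexHull_pair_smul_eq v₁' v₂' hp' hq'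
  set C := convexHull ℝ ({v₀} ×ˢ {v₁', v₂'} ∪ {v₁, v₂} ×ˢ {v₀'} ∪ {v₁, v₂} ×ˢ {v₁', v₂'})
  have m₁ : (v₀, n') ∈ C := by
    refine convexHull_mono (s := {v₀} ×ˢ {v₁', v₂'}) (fun _ h => .inl (.inl h)) ?_
    rw [convexHull_prod, convexHull_singleton]
    exact ⟨rfl, hn'⟩
  have m₂ : (n, v₀') ∈ C := by
    refine convexHull_mono (s := {v₁, v₂} ×ˢ {v₀'}) (fun _ h => .inl (.inr h)) ?_
    rw [convexHull_prod, convexHull_singleton]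
    exact ⟨hn, rfl⟩
  have m₃ : (n, n') ∈ C := by
    refine convexHull_mono (s := {v₁, v₂} ×ˢ {v₁', v₂'}) (fun _ h => .inr h) ?_
    rw [convexHull_prod]
    exact ⟨hn, hn'⟩
  have hC : Convex ℝ C := convex_convexHull ℝ _
  have := hC.sum_mem (t := Finset.univ) (w := ![1 - p - q, 1 - p' - q', p + q + p' + q' - 1])
    (z := ![(v₀, n'), (n, v₀'), (n, n')])
    (by intro k _; fin_cases k <;> simp <;> linarith)
    (by simp [Fin.sum_univ_three]; ring)
    (by intro k _; fin_cases k <;> simp [m₁, m₂, m₃])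
  convert this using 1
  rw [Fin.sum_univ_three]
  ext1
  · simp only [add_assoc, e]
    simp
    module
  · simp only [add_assoc, e']
    simp
    module

/-! ### Two objects as a pair of slices -/

theorem convex_relaxation_RU {N : ℕ} (P : Instance N) : Convex ℝ (relaxation (RU P)) := by
  rintro z ⟨hz, hz'⟩ w ⟨hw, hw'⟩ s t hs ht hst
  have ht' : t = 1 - s := by linarith
  refine ⟨⟨fun k l h e => ?_, fun k l h e => ?_, fun k l h e => ?_, fun k l h e => ?_,
    fun k l h => ?_⟩, fun b => ⟨?_, ?_⟩⟩
  · have h1 := mul_le_mul_of_nonneg_left (hz.lb k l h e) hs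
    have h2 := mul_le_mul_of_nonneg_left (hw.lb k l h e) ht
    simp only [Prod.fst_add, Prod.snd_add, Prod.smul_fst, Prod.smul_snd, Pi.add_apply,
      Pi.smul_apply, smul_eq_mul]
    subst ht'
    linarith
  · have h1 := mul_le_mul_of_nonneg_left (hz.ub k l h e) hs
    have h2 := mul_le_mul_of_nonneg_left (hw.ub k l h e) ht
    simp only [Prod.fst_add, Prod.snd_add, Prod.smul_fst, Prod.smul_snd, Pi.add_apply,
      Pi.smul_apply, smul_eq_mul]
    subst ht'
    linarith
  · have h1 := mul_le_mul_of_nonneg_left (hz.prec k l h e) hs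
    have h2 := mul_le_mul_of_nonneg_left (hw.prec k l h e) ht
    simp only [Prod.fst_add, Prod.snd_add, Prod.smul_fst, Prod.smul_snd, Pi.add_apply,
      Pi.smul_apply, smul_eq_mul]
    subst ht'
    linarith
  · have h1 := mul_le_mul_of_nonneg_left (hz.tight k l h e) hs
    have h2 := mul_le_mul_of_nonneg_left (hw.tight k l h e) ht
    simp only [Prod.snd_add, Prod.smul_snd, Pi.add_apply, Pi.smul_apply, smul_eq_mul]
    linarith
  · have h1 := mul_le_mul_of_nonneg_left (hz.disj k l h) hs
    have h2 := mul_le_mul_of_nonneg_left (hw.disj k l h) ht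
    simp only [Prod.snd_add, Prod.smul_snd, Pi.add_apply, Pi.smul_apply, smul_eq_mul]
    linarith
  · have h1 := mul_nonneg hs (hz' b).1
    have h2 := mul_nonneg ht (hw' b).1
    simp only [Prod.snd_add, Prod.smul_snd, Pi.add_apply, Pi.smul_apply, smul_eq_mul]
    linarith
  · have h1 := mul_le_mul_of_nonneg_left (hz' b).2 hs
    have h2 := mul_le_mul_of_nonneg_left (hw' b).2 ht
    simp only [Prod.snd_add, Prod.smul_snd, Pi.add_apply, Pi.smul_apply, smul_eq_mul]
    linarith

/-- The slice of a pair of slices that belongs to a direction. -/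
def dirSlice (v : Slice × Slice) : Dir → Slice
  | Dir.x => v.1
  | Dir.y => v.2

/-- The choice of variables for two objects that is given by its slices in the two directions. -/
def join : Slice × Slice →ₗ[ℝ] Point 2 where
  toFun v :=
    (fun t => if t.1 = 0 then (dirSlice v t.2).1.1 else (dirSlice v t.2).1.2,
     fun b => if b.1.1 = 0 then (dirSlice v b.1.2.2).2.1 else (dirSlice v b.1.2.2).2.2)
  map_add' v w := by
    ext ⟨⟩
    · rename_i k s
      cases s <;> simp only [dirSlice, Prod.fst_add, Prod.snd_add, Pi.add_apply] <;>
        split_ifs <;> rfl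
    · rename_i t h
      obtain ⟨k, l, s⟩ := t
      cases s <;> simp only [dirSlice, Prod.fst_add, Prod.snd_add, Pi.add_apply] <;>
        split_ifs <;> rfl
  map_smul' r v := by
    ext ⟨⟩
    · rename_i k s
      cases s <;> simp only [dirSlice, Prod.smul_fst, Prod.smul_snd, Pi.smul_apply,
        RingHom.id_apply] <;> split_ifs <;> rfl
    · rename_i t h
      obtain ⟨k, l, s⟩ := t
      cases s <;> simp only [dirSlice, Prod.smul_fst, Prod.smul_snd, Pi.smul_apply,
        RingHom.id_apply] <;> split_ifs <;> rfl

/-- The variables of a choice for two objects that belong to the direction `s`. -/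
def slice (z : Point 2) (s : Dir) : Slice :=
  ((z.1 (0, s), z.1 (1, s)), (z.2 ⟨(0, 1, s), zero_ne_one⟩, z.2 ⟨(1, 0, s), one_ne_zero⟩))

theorem join_slice (z : Point 2) : join (slice z Dir.x, slice z Dir.y) = z := by
  ext ⟨⟩
  · rename_i k s
    fin_cases k <;> cases s <;> simp [join, slice, dirSlice]
  · rename_i t h
    obtain ⟨k, l, s⟩ := t
    fin_cases k <;> fin_cases l <;> first | exact absurd rfl h |
      (cases s <;> simp [join, slice, dirSlice])

/-- The data of a two-object instance in one direction. -/
noncomputable def sliceData (P : Instance 2) (hP : P.Admissible)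
    (h : ∀ k l : Fin 2, k ≠ l → ∀ s, P.PM k l s < P.UB l s - P.LB k s) (s : Dir) : SliceData :=
  have m01 := hP.margin_le 0 1 zero_ne_one s
  have m10 := hP.margin_le 1 0 one_ne_zero s
  have d0 := hP.d_nonneg 0 s
  have d1 := hP.d_nonneg 1 s
  have n0 := hP.clrNeg_nonneg 0 s
  have n1 := hP.clrNeg_nonneg 1 s
  have p0 := hP.clrPos_nonneg 0 s
  have p1 := hP.clrPos_nonneg 1 s
  have a1 := le_max_left (P.clrPos 0 s) (P.clrNeg 1 s)
  have a2 := le_max_right (P.clrPos 0 s) (P.clrNeg 1 s)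
  have a3 := le_max_left (P.clrPos 1 s) (P.clrNeg 0 s)
  have a4 := le_max_right (P.clrPos 1 s) (P.clrNeg 0 s)
  { Li := P.LB 0 s
    Ui := P.UB 0 s
    Lj := P.LB 1 s
    Uj := P.UB 1 s
    Pij := P.PM 0 1 s
    Pji := P.PM 1 0 s
    margin_add := by simp only [Instance.clearanceMargin] at m01 m10; linarith
    Lj_le := by simp only [Instance.clearanceMargin] at m01 m10; simp only [Instance.LB]; linarith
    le_Ui := by simp only [Instance.clearanceMargin] at m01 m10; simp only [Instance.UB]; linarith
    Li_le := by simp only [Instance.clearanceMargin] at m01 m10; simp only [Instance.LB]; linarith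
    le_Uj := by simp only [Instance.clearanceMargin] at m01 m10; simp only [Instance.UB]; linarith
    ij_le := (h 0 1 zero_ne_one s).le
    ji_le := (h 1 0 one_ne_zero s).le }

theorem feasible_slice {P : Instance 2} (hP : P.Admissible)
    (h : ∀ k l : Fin 2, k ≠ l → ∀ s, P.PM k l s < P.UB l s - P.LB k s)
    {z : Point 2} (hz : z ∈ relaxation (RU P)) (s : Dir) :
    (sliceData P hP h s).Feasible (slice z s) where
  bLo := hz.1.lb 0 1 zero_ne_one s
  aLo := hz.1.lb 1 0 one_ne_zero s
  aHi := hz.1.ub 0 1 zero_ne_one s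
  bHi := hz.1.ub 1 0 one_ne_zero s
  gHi := hz.1.prec 0 1 zero_ne_one s
  gLo := hz.1.prec 1 0 one_ne_zero s
  p_nonneg := (hz.2 _).1
  q_nonneg := (hz.2 _).1
  add_le := hz.1.tight 0 1 zero_lt_one s

theorem join_mem_relaxation {P : Instance 2} (hP : P.Admissible)
    (h : ∀ k l : Fin 2, k ≠ l → ∀ s, P.PM k l s < P.UB l s - P.LB k s)
    {v : Slice × Slice}
    (hx : (sliceData P hP h Dir.x).Feasible v.1) (hy : (sliceData P hP h Dir.y).Feasible v.2)
    (hsum : 1 ≤ v.1.2.1 + v.1.2.2 + v.2.2.1 + v.2.2.2) : join v ∈ relaxation (RU P) := by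
  have hs : ∀ s, (sliceData P hP h s).Feasible (dirSlice v s) := fun s => by
    cases s
    exacts [hx, hy]
  refine ⟨⟨fun k l hkl s => ?_, fun k l hkl s => ?_, fun k l hkl s => ?_, fun k l hkl s => ?_,
    fun k l hkl => ?_⟩, ?_⟩
  · fin_cases k <;> fin_cases l <;> first | exact absurd rfl hkl | skip
    exacts [(hs s).bLo, (hs s).aLo]
  · fin_cases k <;> fin_cases l <;> first | exact absurd rfl hkl | skip
    exacts [(hs s).aHi, (hs s).bHi]
  · fin_cases k <;> fin_cases l <;> first | exact absurd rfl hkl | skip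
    exacts [(hs s).gHi, (hs s).gLo]
  · fin_cases k <;> fin_cases l <;> first | exact absurd hkl (by decide) | skip
    exact (hs s).add_le
  · fin_cases k <;> fin_cases l <;> first | exact absurd hkl (by decide) | skip
    exact hsum
  · rintro ⟨⟨k, l, s⟩, hkl⟩
    have hp := (hs s).p_nonneg
    have hq := (hs s).q_nonneg
    have hpq := (hs s).add_le
    fin_cases k
    · exact ⟨hp, show (dirSlice v s).2.1 ≤ 1 by linarith⟩
    · exact ⟨hq, show (dirSlice v s).2.2 ≤ 1 by linarith⟩

/-- The indicators of a slice are binary. -/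
def Slice.IsBinary (v : Slice) : Prop := (v.2.1 = 0 ∨ v.2.1 = 1) ∧ (v.2.2 = 0 ∨ v.2.2 = 1)

theorem join_isBinary {v : Slice × Slice} (hx : Slice.IsBinary v.1) (hy : Slice.IsBinary v.2)
    (b : PrecIndex 2) : (join v).2 b = 0 ∨ (join v).2 b = 1 := by
  obtain ⟨⟨k, l, s⟩, hkl⟩ := b
  have hs : Slice.IsBinary (dirSlice v s) := by
    cases s
    exacts [hx, hy]
  fin_cases k
  exacts [hs.1, hs.2]

/-- The relaxation for two objects is contained in the hull of its binary points. -/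
theorem relaxation_subset_convexHull {P : Instance 2} (hP : P.Admissible)
    (h : ∀ k l : Fin 2, k ≠ l → ∀ s, P.PM k l s < P.UB l s - P.LB k s) :
    relaxation (RU P) ⊆
      convexHull ℝ {z | z ∈ relaxation (RU P) ∧ ∀ b, z.2 b = 0 ∨ z.2 b = 1} := by
  intro z hz
  have fx := feasible_slice hP h hz Dir.x
  have fy := feasible_slice hP h hz Dir.y
  obtain ⟨u₀, u₁, u₂, h₀, h₁, h₂, e⟩ := SliceData.exists_decomposition _ fx
  obtain ⟨u₀', u₁', u₂', h₀', h₁', h₂', e'⟩ := SliceData.exists_decomposition _ fy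
  have key := prod_mem_convexHull_coupling ((u₀, (0, 0)) : Slice) (u₁, (1, 0)) (u₂, (0, 1))
    ((u₀', (0, 0)) : Slice) (u₁', (1, 0)) (u₂', (0, 1))
    fx.p_nonneg fx.q_nonneg fx.add_le fy.p_nonneg fy.q_nonneg fy.add_le
    (hz.1.disj 0 1 zero_lt_one)
  rw [← e, ← e'] at key
  have key' := Set.mem_image_of_mem join key
  rw [join_slice, LinearMap.image_convexHull] at key'
  refine convexHull_mono ?_ key'
  rintro _ ⟨v, hv, rfl⟩
  have b₀ (u : ℝ × ℝ) : Slice.IsBinary (u, (0, 0)) := ⟨.inl rfl, .inl rfl⟩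
  have b₁ (u : ℝ × ℝ) : Slice.IsBinary (u, (1, 0)) := ⟨.inr rfl, .inl rfl⟩
  have b₂ (u : ℝ × ℝ) : Slice.IsBinary (u, (0, 1)) := ⟨.inl rfl, .inr rfl⟩
  obtain ⟨v, v'⟩ := v
  rcases hv with (⟨rfl, rfl | rfl⟩ | ⟨rfl | rfl, rfl⟩) | ⟨rfl | rfl, rfl | rfl⟩ <;>
    refine ⟨join_mem_relaxation hP h (by assumption) (by assumption) (by norm_num),
      join_isBinary ?_ ?_⟩ <;> first | exact b₀ _ | exact b₁ _ | exact b₂ _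

theorem isIdeal_RU {P : Instance 2} (hP : P.Admissible)
    (h : ∀ k l : Fin 2, k ≠ l → ∀ s, P.PM k l s < P.UB l s - P.LB k s) :
    IsIdeal (RU P) := by
  intro z hz
  have hK : convexHull ℝ {z | z ∈ relaxation (RU P) ∧ ∀ b, z.2 b = 0 ∨ z.2 b = 1} =
      relaxation (RU P) :=
    (convexHull_min (fun _ hw => hw.1) (convex_relaxation_RU P)).antisymm
      (relaxation_subset_convexHull hP h)
  rw [← hK] at hz
  exact (extremePoints_convexHull_subset hz).2

theorem Instance.Admissible.pair {N : ℕ} {P : Instance N} (hP : P.Admissible) {i j : Fin N}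
    (hij : i ≠ j) : (P.pair i j).Admissible where
  d_nonneg k := hP.d_nonneg _
  clrNeg_nonneg k := hP.clrNeg_nonneg _
  clrPos_nonneg k := hP.clrPos_nonneg _
  margin_le k l hkl s := by
    refine hP.margin_le _ _ ?_ s
    fin_cases k <;> fin_cases l <;> first | exact absurd rfl hkl | skip
    exacts [hij, hij.symm]

end RectPacking

theorem theorem2 {N : ℕ} (P : RectPacking.Instance N) (hP : P.Admissible)
    (i j : Fin N) (hij : i < j)
    (h : ∀ (k l : Fin N) (s : RectPacking.Dir), (k, l, s) ∈ RectPacking.precedences i j →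
      P.PM k l s < P.UB l s - P.LB k s) :
    RectPacking.IsIdeal (RectPacking.RU (P.pair i j)) := by
  refine RectPacking.isIdeal_RU (hP.pair hij.ne) fun k l hkl s => ?_
  fin_cases k <;> fin_cases l <;> first | exact absurd rfl hkl | skip
  · exact h i j s (by cases s <;> simp [RectPacking.precedences])
  · exact h j i s (by cases s <;> simp [RectPacking.precedences])
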